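/- Let $p$ be a prime with $p \equiv 1$ or $p \equiv -1 \pmod 8$, and let $M, N$ be integers with $p = M^2 + 7N^2$ such that $M \equiv 1 \pmod 4$ or $N \equiv 1 \pmod 4$. Then (a) there exist integers $A, B$ with $p = A^2 + 14B^2$ if and only if $2p + M + N \equiv 3 \pmod 8$; (b) there exist integers $C, D$ with $p = 7C^2 + 2D^2$ if and only if $2p + M + N \equiv 7 \pmod 8$. -/

import Mathlib

/-!
If `n = M ^ 2 + 7 * N ^ 2 = A ^ 2 + 14 * B ^ 2`, then `(A + M) * (A - M) = 7 * (N ^ 2 - 2 * B ^ 2)`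
is a norm from `ℤ[√2]`, because `7 = 3 ^ 2 - 2 * 1 ^ 2` is one. A prime at which `2` is a
nonresidue divides a norm to an even power, and it cannot divide both factors, so it divides the odd
part of `A + M` to an even power and that odd part is `±1` modulo `8`. Feeding this into
`2 * (A + M) * M + 7 * N ^ 2 = (A + M) ^ 2 + 14 * B ^ 2` determines `M + N` modulo `8`.

Multiplying by `7` turns `n = 7 * C ^ 2 + 2 * D ^ 2` into `7 * n = (7 * C) ^ 2 + 14 * D ^ 2` and
`n = M ^ 2 + 7 * N ^ 2` into `7 * n = (-7 * N) ^ 2 + 7 * M ^ 2`, so the second form reduces to the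
first.

Conversely, modulo a prime `p ≡ ±1 [ZMOD 8]` of the form `M ^ 2 + 7 * N ^ 2` both `2` and `-7` are
squares, hence so is `-14`, and Thue's lemma gives `x ^ 2 + 14 * y ^ 2 = k * p` with `0 < k ≤ 7`.
Modulo `7` this forces `k` to be a square, so `k ∈ {1, 2, 4, 7}`, and each of these `k` can be
divided out.
-/

open scoped NumberTheorySymbols

section Nonresidues

variable {a u w s t x y : ℤ} {b q : ℕ}

/-- The integers `x` and `y` have no common prime factor at which `a` is a quadratic nonresidue.
Writing nonresidue as `J(a | q) = -1` leaves out `q = 2` and the prime factors of `a`. It is used to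
share out the prime factors of a norm `s ^ 2 - a * t ^ 2` between two factors of it. -/
def CoprimeAtNonresidues (a x y : ℤ) : Prop :=
  ∀ q : ℕ, q.Prime → J(a | q) = -1 → (q : ℤ) ∣ x → ¬ (q : ℤ) ∣ y

theorem CoprimeAtNonresidues.of_isRelPrime (h : IsRelPrime x y) : CoprimeAtNonresidues a x y :=
  fun _ hq _ hx hy => (Nat.prime_iff_prime_int.1 hq).not_isUnit (h hx hy)

theorem not_dvd_sq_sub_mul_sq_of_isCoprime (hq : q.Prime) (ha : J(a | q) = -1)
    (hst : IsCoprime s t) : ¬ (q : ℤ) ∣ s ^ 2 - a * t ^ 2 := by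
  intro hdvd
  have := Fact.mk hq
  obtain ⟨hs, ht⟩ := jacobiSym.prime_dvd_of_eq_neg_one ha hdvd
  exact (Nat.prime_iff_prime_int.1 hq).not_isUnit (hst.isUnit_of_dvd' hs ht)

theorem even_padicValInt_sq_sub_mul_sq [hq : Fact q.Prime] (ha : J(a | q) = -1) (s t : ℤ) :
    Even (padicValInt q (s ^ 2 - a * t ^ 2)) := by
  rcases eq_or_ne (s ^ 2 - a * t ^ 2) 0 with h0 | h0
  · simp [h0]
  have hg : 0 < Int.gcd s t := by
    rw [Int.gcd_pos_iff]
    by_contra! hst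
    simp [hst] at h0
  obtain ⟨s', t', hst, hs, ht⟩ := Int.exists_gcd_one hg
  set g : ℤ := (Int.gcd s t : ℤ)
  have hfac : s ^ 2 - a * t ^ 2 = g * g * (s' ^ 2 - a * t' ^ 2) := by rw [hs, ht]; ring
  have hg0 : g ≠ 0 := by positivity
  have hval : padicValInt q (s' ^ 2 - a * t' ^ 2) = 0 := padicValInt.eq_zero_of_not_dvd
    (not_dvd_sq_sub_mul_sq_of_isCoprime hq.out ha (Int.isCoprime_iff_gcd_eq_one.2 hst))
  rw [hfac, padicValInt.mul (mul_ne_zero hg0 hg0) (right_ne_zero_of_mul (hfac ▸ h0)),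
    padicValInt.mul hg0 hg0, hval, add_zero]
  exact Even.add_self _

theorem jacobiSym_eq_one_of_even_padicValNat (hab : a.gcd b = 1)
    (h : ∀ q ∈ b.primeFactors, J(a | q) = -1 → Even (padicValNat q b)) : J(a | b) = 1 := by
  rcases eq_or_ne b 0 with rfl | hb
  · exact jacobiSym.zero_right a
  have hmul (m n : ℕ) (hmn : m.Coprime n) : J(a | m * n) = J(a | m) * J(a | n) := by
    rcases eq_or_ne m 0 with rfl | hm
    · simp [(Nat.coprime_zero_left n).1 hmn]
    rcases eq_or_ne n 0 with rfl | hn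
    · simp [(Nat.coprime_zero_right m).1 hmn]
    exact jacobiSym.mul_right' a hm hn
  rw [Nat.multiplicative_factorization (fun n => J(a | n)) hmul (jacobiSym.one_right a) hb]
  refine Finset.prod_eq_one fun q hq => ?_
  have hqb : q.Prime ∧ q ∣ b := ⟨Nat.prime_of_mem_primeFactors hq, Nat.dvd_of_mem_primeFactors hq⟩
  have haq : a.gcd q = 1 := Nat.Coprime.of_dvd_right hqb.2 hab
  change J(a | q ^ b.factorization q) = 1
  rw [jacobiSym.pow_right, Nat.factorization_def b hqb.1]
  rcases jacobiSym.eq_one_or_neg_one haq with hJ | hJ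
  · rw [hJ, one_pow]
  · rw [hJ, (h q hq hJ).neg_one_pow]

theorem jacobiSym_natAbs_eq_one_of_mul_eq_sq_sub_mul_sq (hau : IsCoprime a u)
    (h : u * w = s ^ 2 - a * t ^ 2) (huw : CoprimeAtNonresidues a u w) :
    J(a | u.natAbs) = 1 := by
  have hgcd : a.gcd u.natAbs = 1 := by
    simpa only [Int.gcd, Int.natAbs_natCast] using Int.isCoprime_iff_gcd_eq_one.1 hau
  refine jacobiSym_eq_one_of_even_padicValNat hgcd fun q hq hJ => ?_
  obtain ⟨hqp, hqu, hu⟩ := Nat.mem_primeFactors.1 hq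
  have := Fact.mk hqp
  have hqw : ¬ (q : ℤ) ∣ w := huw q hqp hJ (Int.natCast_dvd.2 hqu)
  have hw : w ≠ 0 := by rintro rfl; exact hqw (dvd_zero _)
  have heven := even_padicValInt_sq_sub_mul_sq hJ s t
  rwa [← h, padicValInt.mul (Int.natAbs_ne_zero.1 hu) hw, padicValInt.eq_zero_of_not_dvd hqw,
    add_zero] at heven

end Nonresidues

section Congruences

variable {n A B M N : ℤ}

theorem sq_emod_eight (x : ℤ) :
    x % 2 = 1 ∧ x ^ 2 % 8 = 1 ∨ x % 4 = 2 ∧ x ^ 2 % 8 = 4 ∨ x % 4 = 0 ∧ x ^ 2 % 8 = 0 := by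
  obtain ⟨k, r, hr, hr', rfl⟩ : ∃ k r : ℤ, 0 ≤ r ∧ r < 4 ∧ x = 4 * k + r :=
    ⟨x / 4, x % 4, by omega, by omega, by omega⟩
  rw [show (4 * k + r) ^ 2 = 8 * (2 * k ^ 2 + k * r) + r ^ 2 by ring]
  interval_cases r <;> omega

theorem sq_emod_sixteen_of_emod_four_eq_one {x : ℤ} (hx : x % 4 = 1) :
    x ^ 2 % 16 = (2 * x - 1) % 16 := by
  obtain ⟨k, rfl⟩ : ∃ k, x = 4 * k + 1 := ⟨x / 4, by omega⟩
  rw [show (4 * k + 1) ^ 2 = 2 * (4 * k + 1) - 1 + 16 * k ^ 2 by ring,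
    Int.add_mul_emod_self_left]

theorem emod_of_odd_of_eq_sq_add_fourteen_mul_sq (hn : Odd n) (h : n = A ^ 2 + 14 * B ^ 2) :
    A % 2 = 1 ∧ (n % 8 = 1 ∧ B % 2 = 0 ∨ n % 8 = 7 ∧ B % 2 = 1) := by
  have hA2 := sq_emod_eight A
  have hB2 := sq_emod_eight B
  have := Int.odd_iff.1 hn
  omega

theorem emod_eight_eq_one_or_seven_of_two_pow_mul_eq_add {u : ℤ} {k : ℕ}
    (h : A ^ 2 + 14 * B ^ 2 = M ^ 2 + 7 * N ^ 2) (hMN : CoprimeAtNonresidues 2 M N)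
    (hu : Odd u) (hAM : A + M = 2 ^ k * u) : u % 8 = 1 ∨ u % 8 = 7 := by
  -- `(3 * N + 2 * B) + (N + 3 * B) * √2 = (3 + √2) * (N + B * √2)`
  have hnorm : u * (2 ^ k * (A - M)) = (3 * N + 2 * B) ^ 2 - 2 * (N + 3 * B) ^ 2 := by
    linear_combination h - (A - M) * hAM
  have hcop : CoprimeAtNonresidues 2 u (2 ^ k * (A - M)) := by
    intro q hq hJ hqu hqAM
    have hqZ := Nat.prime_iff_prime_int.1 hq
    have hq2 : ¬ (q : ℤ) ∣ 2 := by
      simpa using not_dvd_sq_sub_mul_sq_of_isCoprime hq hJ (s := 2) (t := 1) isCoprime_one_right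
    have hq7 : ¬ (q : ℤ) ∣ 7 := by
      simpa using not_dvd_sq_sub_mul_sq_of_isCoprime hq hJ (s := 3) (t := 1) isCoprime_one_right
    have hadd : (q : ℤ) ∣ A + M := hAM ▸ hqu.mul_left _
    have hsub : (q : ℤ) ∣ A - M :=
      (hqZ.dvd_or_dvd hqAM).resolve_left fun h2 => hq2 (hqZ.dvd_of_dvd_pow h2)
    have hM : (q : ℤ) ∣ M := by
      have h2M : (q : ℤ) ∣ 2 * M := by
        rw [show 2 * M = (A + M) - (A - M) by ring]
        exact hadd.sub hsub
      exact (hqZ.dvd_or_dvd h2M).resolve_left hq2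
    have hdiff : (q : ℤ) ∣ 7 * (N ^ 2 - 2 * B ^ 2) := by
      rw [show 7 * (N ^ 2 - 2 * B ^ 2) = (A + M) * (A - M) by linear_combination -h]
      exact hadd.mul_right _
    have := Fact.mk hq
    exact hMN q hq hJ hM (jacobiSym.prime_dvd_of_eq_neg_one hJ
      ((hqZ.dvd_or_dvd hdiff).resolve_left hq7)).1
  have hJ := jacobiSym_natAbs_eq_one_of_mul_eq_sq_sub_mul_sq (Int.isCoprime_two_left.2 hu)
    hnorm hcop
  rw [jacobiSym.at_two (Int.natAbs_odd.2 hu), ZMod.χ₈_nat_eq_if_mod_eight] at hJ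
  split_ifs at hJ <;> omega

theorem add_emod_eight_eq_one (h : A ^ 2 + 14 * B ^ 2 = M ^ 2 + 7 * N ^ 2)
    (hcop : CoprimeAtNonresidues 2 M N) (hM : M % 4 = 1) (hN : N % 4 = 0) :
    (M + N) % 8 = 1 := by
  have hn8 : (M ^ 2 + 7 * N ^ 2) % 8 = 1 := by
    have := sq_emod_eight M
    have := sq_emod_eight N
    omega
  obtain ⟨hA, hB⟩ : A % 2 = 1 ∧ B % 2 = 0 := by
    have := emod_of_odd_of_eq_sq_add_fourteen_mul_sq (Int.odd_iff.2 (by omega)) h.symm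
    omega
  wlog hA4 : A % 4 = 1 generalizing A
  · exact this (A := -A) (by rwa [neg_sq]) (by omega) (by omega)
  obtain ⟨u, hu⟩ : ∃ u, A + M = 2 ^ 1 * u := ⟨(A + M) / 2, by omega⟩
  obtain ⟨b, rfl⟩ : ∃ b, B = 2 * b := ⟨B / 2, by omega⟩
  obtain ⟨m, rfl⟩ : ∃ m, N = 4 * m := ⟨N / 4, by omega⟩
  have hu8 := emod_eight_eq_one_or_seven_of_two_pow_mul_eq_add h hcop
    (Int.odd_iff.2 (by omega)) hu
  have hid : u * M + 28 * m ^ 2 = u ^ 2 + 14 * b ^ 2 := by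
    obtain rfl : A = 2 * u - M := by omega
    linarith
  clear h hcop hn8 hA hB hA4 hu
  have hb2 := sq_emod_eight b
  have hm2 : m ^ 2 % 2 = m % 2 := by have := sq_emod_eight m; omega
  have hu2 : u ^ 2 % 8 = 1 := by have := sq_emod_eight u; omega
  rcases hu8 with hu8 | hu8
  · have huM : u * M % 8 = M % 8 := by rw [Int.mul_emod, hu8, one_mul, Int.emod_emod]
    omega
  · have huM : (u * M + M) % 8 = 0 := by
      rw [← add_one_mul]
      exact Int.emod_eq_zero_of_dvd (dvd_mul_of_dvd_left (by omega) M)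
    omega

theorem add_emod_eight_eq_five (h : A ^ 2 + 14 * B ^ 2 = M ^ 2 + 7 * N ^ 2)
    (hcop : CoprimeAtNonresidues 2 M N) (hM : M % 4 = 0) (hN : N % 4 = 1) :
    (M + N) % 8 = 5 := by
  have hn8 : (M ^ 2 + 7 * N ^ 2) % 8 = 7 := by
    have := sq_emod_eight M
    have := sq_emod_eight N
    omega
  obtain ⟨hA, hB⟩ : A % 2 = 1 ∧ B % 2 = 1 := by
    have := emod_of_odd_of_eq_sq_add_fourteen_mul_sq (Int.odd_iff.2 (by omega)) h.symm
    omega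
  obtain ⟨u, rfl⟩ : ∃ u, A = u - M := ⟨A + M, by ring⟩
  have hu8 := emod_eight_eq_one_or_seven_of_two_pow_mul_eq_add (u := u) (k := 0) h hcop
    (Int.odd_iff.2 (by omega)) (by ring)
  have hid : 2 * (u * M) + 7 * N ^ 2 = u ^ 2 + 14 * B ^ 2 := by linarith
  have huM : u * M % 8 = M % 8 := by
    obtain ⟨c, rfl⟩ : ∃ c, u = 2 * c + 1 := ⟨u / 2, by omega⟩
    obtain ⟨m, rfl⟩ : ∃ m, M = 4 * m := ⟨M / 4, by omega⟩
    rw [show (2 * c + 1) * (4 * m) = 4 * m + 8 * (c * m) by ring, Int.add_mul_emod_self_left]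
  have hu2 : u ^ 2 % 16 = 1 := by
    rcases hu8 with hu8 | hu8
    · rw [sq_emod_sixteen_of_emod_four_eq_one (by omega)]
      omega
    · rw [← neg_sq, sq_emod_sixteen_of_emod_four_eq_one (by omega)]
      omega
  have hN2 := sq_emod_sixteen_of_emod_four_eq_one hN
  have hB2 : B ^ 2 % 8 = 1 := by have := sq_emod_eight B; omega
  clear h hcop hn8 hA hB hu8
  omega

theorem two_mul_add_add_emod_eight_eq_three (hn : Odd n) (hMN : n = M ^ 2 + 7 * N ^ 2)
    (hcop : CoprimeAtNonresidues 2 M N) (hsign : M % 4 = 1 ∨ N % 4 = 1)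
    (hAB : n = A ^ 2 + 14 * B ^ 2) : (2 * n + M + N) % 8 = 3 := by
  have hform := hAB.symm.trans hMN
  have hM2 := sq_emod_eight M
  have hN2 := sq_emod_eight N
  rcases (emod_of_odd_of_eq_sq_add_fourteen_mul_sq hn hAB).2 with ⟨hn8, -⟩ | ⟨hn8, -⟩
  · have := add_emod_eight_eq_one hform hcop (by omega) (by omega)
    omega
  · have := add_emod_eight_eq_five hform hcop (by omega) (by omega)
    omega

theorem two_mul_add_add_emod_eight_eq_seven {C D : ℤ} (hn : Odd n) (hMN : n = M ^ 2 + 7 * N ^ 2)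
    (hcop : CoprimeAtNonresidues 2 M N) (hsign : M % 4 = 1 ∨ N % 4 = 1)
    (hCD : n = 7 * C ^ 2 + 2 * D ^ 2) : (2 * n + M + N) % 8 = 7 := by
  have hcop' : CoprimeAtNonresidues 2 (-7 * N) M := by
    intro q hq hJ hqN hqM
    have hq7 : ¬ (q : ℤ) ∣ -7 := by
      simpa using not_dvd_sq_sub_mul_sq_of_isCoprime hq hJ (s := 1) (t := 2) isCoprime_one_left
    exact hcop q hq hJ hqM (((Nat.prime_iff_prime_int.1 hq).dvd_or_dvd hqN).resolve_left hq7)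
  have h7n := two_mul_add_add_emod_eight_eq_three (n := 7 * n) (A := 7 * C) (B := D)
    (Odd.mul (by decide) hn) (by rw [hMN]; ring) hcop' (by omega) (by rw [hCD]; ring)
  have := Int.odd_iff.1 hn
  omega

end Congruences

section Representation

theorem isRelPrime_of_squarefree_sq_add_mul_sq {R : Type*} [CommRing R] {d x y : R}
    (h : Squarefree (x ^ 2 + d * y ^ 2)) : IsRelPrime x y := by
  rintro z ⟨x', rfl⟩ ⟨y', rfl⟩
  exact h z ⟨x' ^ 2 + d * y' ^ 2, by ring⟩

theorem isSquare_neg_of_prime_eq_sq_add_mul_sq {p : ℕ} [hp : Fact p.Prime] {d x y : ℤ}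
    (h : (p : ℤ) = x ^ 2 + d * y ^ 2) : IsSquare (-d : ZMod p) := by
  have hpZ := Nat.prime_iff_prime_int.1 hp.out
  have hxy : IsRelPrime x y := isRelPrime_of_squarefree_sq_add_mul_sq (h ▸ hpZ.squarefree)
  have hy : (y : ZMod p) ≠ 0 := by
    rw [Ne, ZMod.intCast_zmod_eq_zero_iff_dvd]
    intro hpy
    have hpx : (p : ℤ) ∣ x ^ 2 := by
      rw [← dvd_add_left ((hpy.pow two_ne_zero).mul_left d), ← h]
    exact hpZ.not_isUnit (hxy (hpZ.dvd_of_dvd_pow hpx) hpy)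
  have hzero : (x : ZMod p) ^ 2 + d * y ^ 2 = 0 := by
    simpa using (congrArg (Int.cast : ℤ → ZMod p) h).symm
  exact ⟨x / y, by field_simp; linear_combination -hzero⟩

theorem exists_ne_zero_abs_le_intCast_eq_mul {n : ℕ} [NeZero n] (r : ZMod n) {X Y : ℕ}
    (hXY : n < (X + 1) * (Y + 1)) :
    ∃ x y : ℤ, (x ≠ 0 ∨ y ≠ 0) ∧ |x| ≤ X ∧ |y| ≤ Y ∧ (x : ZMod n) = r * y := by
  obtain ⟨⟨a₁, a₂⟩, ha, ⟨b₁, b₂⟩, hb, hab, hf⟩ := Finset.exists_ne_map_eq_of_card_lt_of_maps_to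
    (s := Finset.range (X + 1) ×ˢ Finset.range (Y + 1)) (t := (Finset.univ : Finset (ZMod n)))
    (f := fun a => (a.1 : ZMod n) - r * a.2)
    (by simpa [ZMod.card] using hXY) (fun _ _ => Finset.mem_coe.2 (Finset.mem_univ _))
  simp only [Finset.mem_product, Finset.mem_range] at ha hb
  simp only [ne_eq, Prod.mk.injEq] at hab
  refine ⟨a₁ - b₁, a₂ - b₂, by omega, ?_, ?_, ?_⟩
  · rw [abs_le]; omega
  · rw [abs_le]; omega
  · push_cast
    linear_combination hf

theorem exists_sq_add_mul_sq_eq_mul {n d a : ℕ} [NeZero n] (hd : 0 < d) (ha : 0 < a)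
    {r : ZMod n} (hr : r ^ 2 = -d) :
    ∃ x y k : ℤ, x ^ 2 + d * y ^ 2 = k * n ∧ 0 < k ∧ a * k ≤ a ^ 2 + d := by
  have hn : (0 : ℤ) < n := by exact_mod_cast NeZero.pos n
  -- the box `|x| ≤ √(a * n)`, `|y| ≤ √(n / a)` has just enough lattice points for Thue's lemma
  have hcard : n < (Nat.sqrt (a * n) + 1) * (Nat.sqrt (n / a) + 1) := by
    have hX := Nat.lt_succ_sqrt' (a * n)
    have hY := (Nat.div_lt_iff_lt_mul ha).1 (Nat.lt_succ_sqrt' (n / a))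
    refine lt_of_pow_lt_pow_left₀ 2 (Nat.zero_le _) (lt_of_mul_lt_mul_left ?_ ha.le)
    calc a * n ^ 2 = a * n * n := by ring
      _ < (Nat.sqrt (a * n) + 1) ^ 2 * ((Nat.sqrt (n / a) + 1) ^ 2 * a) := Nat.mul_lt_mul'' hX hY
      _ = a * ((Nat.sqrt (a * n) + 1) * (Nat.sqrt (n / a) + 1)) ^ 2 := by ring
  obtain ⟨x, y, hne, hx, hy, hxy⟩ := exists_ne_zero_abs_le_intCast_eq_mul r hcard
  have hx2 : x ^ 2 ≤ a * n :=
    calc x ^ 2 ≤ (Nat.sqrt (a * n) : ℤ) ^ 2 := sq_le_sq.2 (hx.trans (le_abs_self _))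
      _ ≤ a * n := by exact_mod_cast Nat.sqrt_le' (a * n)
  have hy2 : (a : ℤ) * y ^ 2 ≤ (n : ℤ) :=
    calc (a : ℤ) * y ^ 2 ≤ a * (Nat.sqrt (n / a) : ℤ) ^ 2 := by
          exact mul_le_mul_of_nonneg_left (sq_le_sq.2 (hy.trans (le_abs_self _))) (by positivity)
      _ ≤ (n : ℤ) := by
          exact_mod_cast (Nat.mul_le_mul_left a (Nat.sqrt_le' (n / a))).trans (Nat.mul_div_le n a)
  obtain ⟨k, hk⟩ : (n : ℤ) ∣ x ^ 2 + d * y ^ 2 := by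
    rw [← ZMod.intCast_zmod_eq_zero_iff_dvd]
    push_cast
    rw [hxy]
    linear_combination (y : ZMod n) ^ 2 * hr
  have hpos : 0 < x ^ 2 + d * y ^ 2 := by
    rcases hne with h | h <;> positivity
  refine ⟨x, y, k, by rw [hk, mul_comm], pos_of_mul_pos_right (hk ▸ hpos) hn.le,
    le_of_mul_le_mul_left ?_ hn⟩
  calc (n : ℤ) * (a * k) = a * x ^ 2 + d * (a * y ^ 2) := by linear_combination -a * hk
    _ ≤ a * (a * n) + d * n := by gcongr
    _ = n * (a ^ 2 + d) := by ring

theorem isSquare_intCast_of_sq_add_fourteen_mul_sq_eq_mul {k M N x y : ℤ} (hM : ¬ (7 : ℤ) ∣ M)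
    (h : x ^ 2 + 14 * y ^ 2 = k * (M ^ 2 + 7 * N ^ 2)) : IsSquare (k : ZMod 7) := by
  have := Fact.mk Nat.prime_seven
  have hM0 : (M : ZMod 7) ≠ 0 := by
    rw [Ne, ZMod.intCast_zmod_eq_zero_iff_dvd]
    exact_mod_cast hM
  have hcast := congrArg (Int.cast : ℤ → ZMod 7) h
  have h7 : (7 : ZMod 7) = 0 := CharP.cast_eq_zero (ZMod 7) 7
  push_cast at hcast
  refine ⟨x / M, ?_⟩
  field_simp
  linear_combination -hcast + (2 * (y : ZMod 7) ^ 2 - k * (N : ZMod 7) ^ 2) * h7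

theorem exists_eq_of_sq_add_fourteen_mul_sq_eq_mul {n k x y : ℤ}
    (hk : k = 1 ∨ k = 2 ∨ k = 4 ∨ k = 7) (h : x ^ 2 + 14 * y ^ 2 = k * n) :
    (∃ A B : ℤ, n = A ^ 2 + 14 * B ^ 2) ∨ ∃ C D : ℤ, n = 7 * C ^ 2 + 2 * D ^ 2 := by
  rcases hk with rfl | rfl | rfl | rfl
  · exact Or.inl ⟨x, y, by linarith⟩
  · obtain ⟨c, rfl⟩ : 2 ∣ x :=
      Int.prime_two.dvd_of_dvd_pow (n := 2) ⟨n - 7 * y ^ 2, by linarith⟩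
    exact Or.inr ⟨y, c, by linarith⟩
  · obtain ⟨c, rfl⟩ : 2 ∣ x :=
      Int.prime_two.dvd_of_dvd_pow (n := 2) ⟨2 * n - 7 * y ^ 2, by linarith⟩
    obtain ⟨d, rfl⟩ : 2 ∣ y :=
      Int.prime_two.dvd_of_dvd_pow (n := 2) ⟨n - 3 * y ^ 2 - c ^ 2, by linarith⟩
    exact Or.inl ⟨c, d, by linarith⟩
  · obtain ⟨c, rfl⟩ : 7 ∣ x :=
      Prime.dvd_of_dvd_pow (n := 2) (by norm_num) ⟨n - 2 * y ^ 2, by linarith⟩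
    exact Or.inr ⟨c, y, by linarith⟩

variable {p : ℕ} {M N : ℤ}

theorem exists_eq_sq_add_fourteen_mul_sq_or (hp : p.Prime) (hp8 : p % 8 = 1 ∨ p % 8 = 7)
    (h : (p : ℤ) = M ^ 2 + 7 * N ^ 2) :
    (∃ A B : ℤ, (p : ℤ) = A ^ 2 + 14 * B ^ 2) ∨ ∃ C D : ℤ, (p : ℤ) = 7 * C ^ 2 + 2 * D ^ 2 := by
  rcases eq_or_ne p 7 with rfl | hp7
  · exact Or.inr ⟨1, 0, by norm_num⟩
  have := Fact.mk hp
  have hM : ¬ (7 : ℤ) ∣ M := fun hM => by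
    have h7p : (7 : ℤ) ∣ p := h ▸ (hM.pow two_ne_zero).add (dvd_mul_right _ _)
    exact hp7 ((Nat.prime_dvd_prime_iff_eq Nat.prime_seven hp).1 (by exact_mod_cast h7p)).symm
  have h2 : IsSquare (2 : ZMod p) := (ZMod.exists_sq_eq_two_iff (by omega)).2 hp8
  obtain ⟨r, hr⟩ := h2.mul (isSquare_neg_of_prime_eq_sq_add_mul_sq h)
  -- `a = 4` minimizes the bound `a + 14 / a` on `k` over the integers
  obtain ⟨x, y, k, hk, hk0, hk7⟩ := exists_sq_add_mul_sq_eq_mul (n := p) (d := 14) (a := 4)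
    (r := r) (by norm_num) (by norm_num) (by push_cast at hr ⊢; linear_combination -hr)
  push_cast at hk hk7
  have hsq := isSquare_intCast_of_sq_add_fourteen_mul_sq_eq_mul hM (h ▸ hk)
  refine exists_eq_of_sq_add_fourteen_mul_sq_eq_mul ?_ hk
  have hk7' : k ≤ 7 := by omega
  interval_cases k <;> first | omega | exact absurd hsq (by decide)

end Representation

theorem mainTheorem10_general (p : ℕ) (hp : p.Prime) (M N : ℤ)
    (hpMN : (p : ℤ) = M ^ 2 + 7 * N ^ 2)
    (hMN : M ≡ 1 [ZMOD 4] ∨ N ≡ 1 [ZMOD 4]) :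
    ((∃ A B : ℤ, (p : ℤ) = A ^ 2 + 14 * B ^ 2) ↔ 2 * (p : ℤ) + M + N ≡ 3 [ZMOD 8]) ∧
    ((∃ C D : ℤ, (p : ℤ) = 7 * C ^ 2 + 2 * D ^ 2) ↔ 2 * (p : ℤ) + M + N ≡ 7 [ZMOD 8]) := by
  have hcop : CoprimeAtNonresidues 2 M N := .of_isRelPrime
    (isRelPrime_of_squarefree_sq_add_mul_sq (hpMN ▸ (Nat.prime_iff_prime_int.1 hp).squarefree))
  have hM2 := sq_emod_eight M
  have hN2 := sq_emod_eight N
  unfold Int.ModEq at *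
  have hodd : Odd (p : ℤ) := by
    rcases hp.eq_two_or_odd with rfl | hp2 <;> rw [Int.odd_iff] <;> omega
  have h14 : (∃ A B : ℤ, (p : ℤ) = A ^ 2 + 14 * B ^ 2) → (2 * (p : ℤ) + M + N) % 8 = 3 :=
    fun ⟨_, _, h⟩ => two_mul_add_add_emod_eight_eq_three hodd hpMN hcop hMN h
  have h72 : (∃ C D : ℤ, (p : ℤ) = 7 * C ^ 2 + 2 * D ^ 2) → (2 * (p : ℤ) + M + N) % 8 = 7 :=
    fun ⟨_, _, h⟩ => two_mul_add_add_emod_eight_eq_seven hodd hpMN hcop hMN h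
  have hor (h : (2 * (p : ℤ) + M + N) % 4 = 3) :=
    exists_eq_sq_add_fourteen_mul_sq_or hp (by omega) hpMN
  refine ⟨⟨h14, fun h => (hor (by omega)).resolve_right fun h' => ?_⟩,
    ⟨h72, fun h => (hor (by omega)).resolve_left fun h' => ?_⟩⟩
  · have := h72 h'
    omega
  · have := h14 h'
    omega

theorem mainTheorem10 (p : ℕ) (hp : p.Prime) (hp8 : (p : ℤ) ≡ 1 [ZMOD 8] ∨ (p : ℤ) ≡ -1 [ZMOD 8])
    (M N : ℤ) (hpMN : (p : ℤ) = M ^ 2 + 7 * N ^ 2)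
    (hMN : M ≡ 1 [ZMOD 4] ∨ N ≡ 1 [ZMOD 4]) :
    ((∃ A B : ℤ, (p : ℤ) = A ^ 2 + 14 * B ^ 2) ↔ 2 * (p : ℤ) + M + N ≡ 3 [ZMOD 8]) ∧
    ((∃ C D : ℤ, (p : ℤ) = 7 * C ^ 2 + 2 * D ^ 2) ↔ 2 * (p : ℤ) + M + N ≡ 7 [ZMOD 8]) :=
  mainTheorem10_general p hp M N hpMN hMN
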